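/- Let $X$ and $Y$ be random vectors in $\mathbb{R}^{d_x}$ and $\mathbb{R}^{d_y}$ on a common probability space, with mutual information $I(X;Y)\in[0,\infty]$ (the Kullback--Leibler divergence of the joint law from the product of the marginal laws). Nonlinear canonical (ACE) pairs $(U_1,V_1),(U_2,V_2),\dots$ of $X$ and $Y$ are defined one after the other: $(U_i,V_i)$ maximizes $E(UV)$ over all $U=f(X)$, $V=g(Y)$ ($f,g$ Borel) with $E(U)=E(V)=0$, $E(U^2)=E(V^2)=1$, $E(UU_j)=0$ and $E(VV_j)=0$ for all $j<i$. The vectors of the first $k$ pairs are written $\underline{U}_*=(U_1,\dots,U_k)$, $\underline{V}_*=(V_1,\dots,V_k)$; the log-det objective they attain is $J_k=-\tfrac12\log\left|C_{[\underline{U}_*,\underline{V}_*]}\right|$, where $C_{[\underline{U}_*,\underline{V}_*]}$ is the $2k\times 2k$ covariance matrix of the concatenated vector ($J_k=+\infty$ if the determinant is $0$). A *lossless Gaussianization* of output dimensions $(k_x,k_y)$, $k_x,k_y\ge 0$, is a pair of Borel maps $\varphi:\mathbb{R}^{d_x}\to\mathbb{R}^{k_x}$, $\psi:\mathbb{R}^{d_y}\to\mathbb{R}^{k_y}$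 such that $(\varphi(X),\psi(Y))$ is jointly normal (possibly degenerate) and $I(\varphi(X);\psi(Y))=I(X;Y)$. 1. Suppose that the canonical pairs are exhausted after $k$ pairs, i.e. no further pair satisfying the constraints has positive correlation. If $I(X;Y)>J_k$, then there is no lossless Gaussianization of any output dimensions $k_x,k_y\ge0$. 2. Suppose that $(U_i,V_i)_{i\ge1}$ is an infinite sequence of canonical pairs. If $I(X;Y)>\sup_k J_k$, then there is no lossless Gaussianization of any output dimensions $k_x,k_y\ge0$. 3. Suppose that only the first $k$ canonical pairs are given. If $I(X;Y)>J_k$, then there is no lossless Gaussianization of output dimensions $k_x,k_y$ with $\min\{k_x,k_y\}\le k$. -/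

import Mathlib

open MeasureTheory ProbabilityTheory

noncomputable section

/-- The mutual information (in nats) of two random variables on `(Ω, P)`: the Kullback-Leibler
divergence of their joint law from the product of their marginal laws, with values in `[0, ∞]`. -/
def mutualInfo {Ω E F : Type*} [MeasurableSpace Ω] [MeasurableSpace E] [MeasurableSpace F]
    (P : Measure Ω) (X : Ω → E) (Y : Ω → F) : ENNReal :=
  InformationTheory.klDiv (P.map (fun ω => (X ω, Y ω))) ((P.map X).prod (P.map Y))

/-- `f` is admissible as the component number `i` (counting from `0`) of a canonical vector of `X`
whose components `0, …, i - 1` are `u 0 (X), …, u (i - 1) (X)`: the variable `f (X)` has zero mean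
and unit variance and is orthogonal to the components found before. -/
structure IsAdmissible {Ω E : Type*} [MeasurableSpace Ω] [MeasurableSpace E]
    (P : Measure Ω) (X : Ω → E) (u : ℕ → E → ℝ) (i : ℕ) (f : E → ℝ) : Prop where
  measurable : Measurable f
  memLp : MemLp (fun ω => f (X ω)) 2 P
  mean : ∫ ω, f (X ω) ∂P = 0
  second_moment : ∫ ω, f (X ω) ^ 2 ∂P = 1
  orthogonal : ∀ j < i, ∫ ω, f (X ω) * u j (X ω) ∂P = 0

/-- The first `k` terms of `u` and `v` are the transformations giving `k` nonlinear canonical pairs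
`(U_i, V_i) = (u i (X), v i (Y))`: for each `i < k`, the pair `(U_i, V_i)` has maximal correlation
among all pairs of zero-mean, unit-variance transformations of `X` and of `Y` that are orthogonal to
the previous `U_j` and to the previous `V_j`, respectively. -/
def IsCanonical {Ω E F : Type*} [MeasurableSpace Ω] [MeasurableSpace E] [MeasurableSpace F]
    (P : Measure Ω) (X : Ω → E) (Y : Ω → F) (k : ℕ) (u : ℕ → E → ℝ) (v : ℕ → F → ℝ) : Prop :=
  ∀ i < k, IsAdmissible P X u i (u i) ∧ IsAdmissible P Y v i (v i) ∧
    ∀ (f : E → ℝ) (g : F → ℝ), IsAdmissible P X u i f → IsAdmissible P Y v i g →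
      ∫ ω, f (X ω) * g (Y ω) ∂P ≤ ∫ ω, u i (X ω) * v i (Y ω) ∂P

/-- The extraction of canonical pairs is exhausted after `k` pairs: no admissible further pair has
a positive correlation. -/
def IsExhausted {Ω E F : Type*} [MeasurableSpace Ω] [MeasurableSpace E] [MeasurableSpace F]
    (P : Measure Ω) (X : Ω → E) (Y : Ω → F) (k : ℕ) (u : ℕ → E → ℝ) (v : ℕ → F → ℝ) : Prop :=
  ∀ (f : E → ℝ) (g : F → ℝ), IsAdmissible P X u k f → IsAdmissible P Y v k g →
    ∫ ω, f (X ω) * g (Y ω) ∂P ≤ 0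

/-- The concatenated vector `[U, V]`, where `U_i = u i (X)` and `V_i = v i (Y)` for `i < k`. -/
def concatVector {Ω E F : Type*} (X : Ω → E) (Y : Ω → F) (k : ℕ)
    (u : ℕ → E → ℝ) (v : ℕ → F → ℝ) : Fin k ⊕ Fin k → Ω → ℝ :=
  Sum.elim (fun i ω => u i (X ω)) (fun i ω => v i (Y ω))

/-- The covariance matrix of a finite family of real random variables. -/
def covMatrix {Ω ι : Type*} [MeasurableSpace Ω] (P : Measure Ω) (Z : ι → Ω → ℝ) : Matrix ι ι ℝ :=
  Matrix.of fun a b => cov[Z a, Z b; P]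

/-- The log-det objective `-(1/2) log |C_[U, V]|` attained by the first `k` pairs, as an extended
real number: it is `+∞` if the determinant vanishes. -/
def logDetObjective {Ω E F : Type*} [MeasurableSpace Ω] (P : Measure Ω) (X : Ω → E) (Y : Ω → F)
    (k : ℕ) (u : ℕ → E → ℝ) (v : ℕ → F → ℝ) : EReal :=
  -(ENNReal.log (ENNReal.ofReal (covMatrix P (concatVector X Y k u v)).det)) / 2

/-- There are (Borel) transformations `φ : E → ℝ^kx` and `ψ : F → ℝ^ky` such that `φ (X)` and
`ψ (Y)` are jointly normal (possibly degenerate) and preserve all of the mutual information. -/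
def HasLosslessGaussianization {Ω E F : Type*} [MeasurableSpace Ω] [MeasurableSpace E]
    [MeasurableSpace F] (P : Measure Ω) (X : Ω → E) (Y : Ω → F) (kx ky : ℕ) : Prop :=
  ∃ (φ : E → EuclideanSpace ℝ (Fin kx)) (ψ : F → EuclideanSpace ℝ (Fin ky)),
    Measurable φ ∧ Measurable ψ ∧
    IsGaussian (P.map (fun ω => (φ (X ω), ψ (Y ω)))) ∧
    mutualInfo P (fun ω => φ (X ω)) (fun ω => ψ (Y ω)) = mutualInfo P X Y

end

/-!
If `A = φ (X)` and `B = ψ (Y)` are jointly normal and `I(A; B) = I(X; Y)`, then the information of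
the Gaussian pair is bounded by the log-det objective of the canonical pairs; the theorem is the
contrapositive of this bound.

The centred linear functionals of `A` and of `B` form finite-dimensional subspaces of `L²(P)`. The
singular value decomposition of their covariance form (`exists_singular_vectors`) gives orthonormal
Gaussian variables `a i`, `b i`, for `i < m ≤ min kx ky`, with `E(a i * b j) = 0` for `i ≠ j` and
correlations `ρ 0 ≥ ρ 1 ≥ ⋯ > 0` that carry all of the dependence between `A` and `B`.

* Information. Splitting the independent pairs `(a i, b i)` off one by one leaves independent
  residuals, so that `I(A; B) ≤ -(1/2) ∑ log (1 - ρ i ^ 2)` if all `ρ i < 1`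
  (`mutualInfo_le_sum_of_gaussian`). Only this inequality is needed. It uses the data processing
  inequality, the chain rule of the Kullback-Leibler divergence and the density of a bivariate
  normal law.
* Correlations. The greedy choice of the canonical pairs `(U i, V i)` makes `U i` and `V j`
  orthogonal for `i ≠ j`, by first-order optimality (`IsCanonicalSeq.inner_eq_zero`). If the
  canonical pairs before stage `i < m` are given, a Courant-Fischer argument
  (`IsCanonicalSeq.exists_inner_ge`) yields an admissible pair at stage `i` with correlation at
  least `ρ i`. Hence `ρ i ≤ σ i = E(U i * V i)` if the next canonical pair is given as well, and
  exhaustion after `k` pairs forces `m ≤ k`. In the infinite case one takes `k = m`, and in the last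
  case `m ≤ min kx ky ≤ k` by assumption.

The covariance matrix of the canonical vector has determinant `∏ (1 - σ i ^ 2)`
(`IsCanonical.det_covMatrix`), which is at most `∏ (1 - ρ i ^ 2)` once `m ≤ k`. If it vanishes, the
objective is `⊤` and there is nothing to prove; otherwise all `ρ i < 1`.
-/

open scoped RealInnerProductSpace

noncomputable section

/-! ### Canonical sequences in a Hilbert space -/

section HilbertSpace

variable {H : Type*} [NormedAddCommGroup H] [InnerProductSpace ℝ H]

/-- `x` is a unit vector of `K` orthogonal to `u 0, …, u (i - 1)`: the Hilbert space form of
admissibility at stage `i`. -/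
structure IsUnitOrthogonal (K : Submodule ℝ H) (u : ℕ → H) (i : ℕ) (x : H) : Prop where
  mem : x ∈ K
  norm_eq_one : ‖x‖ = 1
  orthogonal : ∀ j < i, ⟪x, u j⟫ = 0

/-- The first `k` terms of `u` and `v` are canonical pairs of the subspaces `K` and `L`: for each
`i < k` the pair `(u i, v i)` maximizes the inner product among the unit vectors of `K` and `L`
orthogonal to the vectors chosen before. -/
def IsCanonicalSeq (K L : Submodule ℝ H) (k : ℕ) (u v : ℕ → H) : Prop :=
  ∀ i < k, IsUnitOrthogonal K u i (u i) ∧ IsUnitOrthogonal L v i (v i) ∧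
    ∀ x y, IsUnitOrthogonal K u i x → IsUnitOrthogonal L v i y → ⟪x, y⟫ ≤ ⟪u i, v i⟫

lemma IsCanonicalSeq.symm {K L : Submodule ℝ H} {k : ℕ} {u v : ℕ → H}
    (h : IsCanonicalSeq K L k u v) : IsCanonicalSeq L K k v u := by
  intro i hi
  obtain ⟨h1, h2, h3⟩ := h i hi
  refine ⟨h2, h1, fun x y hx hy => ?_⟩
  rw [real_inner_comm, real_inner_comm (u i)]
  exact h3 y x hy hx

lemma IsCanonicalSeq.mono {K L : Submodule ℝ H} {k l : ℕ} {u v : ℕ → H}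
    (h : IsCanonicalSeq K L k u v) (hl : l ≤ k) : IsCanonicalSeq K L l u v :=
  fun i hi => h i (hi.trans_le hl)

lemma IsUnitOrthogonal.neg {K : Submodule ℝ H} {u : ℕ → H} {i : ℕ} {x : H}
    (h : IsUnitOrthogonal K u i x) : IsUnitOrthogonal K u i (-x) :=
  ⟨K.neg_mem h.mem, by rw [norm_neg, h.norm_eq_one], fun j hj => by
    rw [inner_neg_left, h.orthogonal j hj, neg_zero]⟩

lemma IsUnitOrthogonal.normalize {K : Submodule ℝ H} {u : ℕ → H} {i : ℕ} {x : H}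
    (hx : x ∈ K) (hx0 : x ≠ 0) (ho : ∀ j < i, ⟪x, u j⟫ = 0) :
    IsUnitOrthogonal K u i (‖x‖⁻¹ • x) :=
  ⟨K.smul_mem _ hx, norm_smul_inv_norm hx0, fun j hj => by
    rw [real_inner_smul_left, ho j hj, mul_zero]⟩

lemma IsCanonicalSeq.inner_nonneg {K L : Submodule ℝ H} {k : ℕ} {u v : ℕ → H}
    (h : IsCanonicalSeq K L k u v) {i : ℕ} (hi : i < k) : 0 ≤ ⟪u i, v i⟫ := by
  obtain ⟨h1, h2, h3⟩ := h i hi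
  have := h3 _ _ h1.neg h2
  rw [inner_neg_left] at this
  linarith

lemma IsCanonicalSeq.inner_le_one {K L : Submodule ℝ H} {k : ℕ} {u v : ℕ → H}
    (h : IsCanonicalSeq K L k u v) {i : ℕ} (hi : i < k) : ⟪u i, v i⟫ ≤ 1 := by
  obtain ⟨h1, h2, -⟩ := h i hi
  have := real_inner_le_norm (u i) (v i)
  rwa [h1.norm_eq_one, h2.norm_eq_one, one_mul] at this

/-- First-order optimality: adding to `u i` a small multiple of an admissible direction `x` changes
the inner product with `v i` to first order by `⟪x, v i⟫`, and the norm only to second order. -/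
lemma IsCanonicalSeq.inner_eq_zero {K L : Submodule ℝ H} {k : ℕ} {u v : ℕ → H}
    (h : IsCanonicalSeq K L k u v) {i : ℕ} (hi : i < k) {x : H} (hx : x ∈ K)
    (ho : ∀ j ≤ i, ⟪x, u j⟫ = 0) : ⟪x, v i⟫ = 0 := by
  obtain ⟨h1, h2, h3⟩ := h i hi
  have hs := h.inner_nonneg hi
  set s := ⟪u i, v i⟫
  set d := ⟪x, v i⟫ with hd
  by_contra hd0
  set n := ‖x‖ ^ 2 with hn
  have hn0 : 0 ≤ n := sq_nonneg _
  -- a step size for which the first-order gain beats the second-order loss `s * n * e / 2`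
  set e : ℝ := 1 / (s * n + 1) with he
  have hsn : 0 ≤ s * n := mul_nonneg hs hn0
  have he0 : 0 < e := by positivity
  set z := u i + (e * d) • x with hz
  have hzn : ‖z‖ ^ 2 = 1 + (e * d) ^ 2 * n := by
    have h0 : ⟪u i, (e * d) • x⟫ = 0 := by
      rw [real_inner_smul_right, real_inner_comm, ho i le_rfl, mul_zero]
    rw [hz, norm_add_sq_real, h0, h1.norm_eq_one, norm_smul, mul_pow, Real.norm_eq_abs, sq_abs]
    ring
  have hz1 : 0 < ‖z‖ := by
    have : 0 < ‖z‖ ^ 2 := by rw [hzn]; positivity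
    exact lt_of_pow_lt_pow_left₀ 2 (norm_nonneg _) (by simpa using this)
  have hzo : ∀ j < i, ⟪z, u j⟫ = 0 := fun j hj => by
    rw [hz, inner_add_left, real_inner_smul_left, ho j hj.le, h1.orthogonal j hj]; simp
  have hzK : z ∈ K := K.add_mem h1.mem (K.smul_mem (e * d) hx)
  have hzv : ⟪z, v i⟫ = s + e * d * d := by rw [hz, inner_add_left, real_inner_smul_left]
  have h4 := h3 _ _ (IsUnitOrthogonal.normalize hzK (norm_pos_iff.1 hz1) hzo) h2
  rw [real_inner_smul_left, hzv, inv_mul_le_iff₀ hz1] at h4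
  have h5 : ‖z‖ ≤ 1 + (e * d) ^ 2 * n / 2 := by
    nlinarith [sq_nonneg (‖z‖ - 1)]
  have h6 : ‖z‖ * s ≤ (1 + (e * d) ^ 2 * n / 2) * s := mul_le_mul_of_nonneg_right h5 hs
  have h7 : e * d * d ≤ (e * d) ^ 2 * n / 2 * s := by linarith
  have h8 : e * (s * n) < 1 := by
    rw [he, one_div, inv_mul_lt_iff₀ (by positivity)]; linarith
  have h9 : 0 < e * d ^ 2 := by positivity
  nlinarith

lemma IsCanonicalSeq.inner_eq_zero_of_ne {K L : Submodule ℝ H} {k : ℕ} {u v : ℕ → H}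
    (h : IsCanonicalSeq K L k u v) {i j : ℕ} (hi : i < k) (hj : j < k) (hij : i ≠ j) :
    ⟪u i, v j⟫ = 0 := by
  wlog hlt : j < i generalizing K L u v i j
  · rw [real_inner_comm]
    exact this h.symm hj hi hij.symm (lt_of_le_of_ne (not_lt.1 hlt) hij)
  exact h.inner_eq_zero hj (h i hi).1.mem fun l hl => (h i hi).1.orthogonal l (hl.trans_lt hlt)

lemma exists_ne_zero_forall_dual_eq_zero {i : ℕ} (φ : Fin i → (Fin (i + 1) → ℝ) →ₗ[ℝ] ℝ) :
    ∃ c : Fin (i + 1) → ℝ, c ≠ 0 ∧ ∀ j, φ j c = 0 := by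
  have : 0 < Module.finrank ℝ (LinearMap.ker (LinearMap.pi φ)) := by
    have h1 := (LinearMap.pi φ).finrank_range_add_finrank_ker
    have h2 := Submodule.finrank_le (LinearMap.range (LinearMap.pi φ))
    simp only [Module.finrank_fin_fun] at h1 h2
    omega
  have := Module.finrank_pos_iff.1 this
  obtain ⟨⟨c, hc⟩, hc0⟩ := exists_ne (0 : LinearMap.ker (LinearMap.pi φ))
  refine ⟨c, fun h => hc0 (Subtype.ext h), fun j => ?_⟩
  exact congrFun (LinearMap.mem_ker.1 hc) j

/-- The minimax step: if the pairs before stage `i` are canonical and `a`, `b` are biorthogonal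
systems with decreasing correlations `ρ`, some pair admissible at stage `i` has inner product at
least `ρ i`. -/
lemma IsCanonicalSeq.exists_inner_ge {K L : Submodule ℝ H} {i m : ℕ} {u v : ℕ → H}
    (h : IsCanonicalSeq K L i u v) (hi : i < m) {a b : Fin m → H} {ρ : Fin m → ℝ}
    (ha : Orthonormal ℝ a) (hb : Orthonormal ℝ b) (haK : ∀ l, a l ∈ K) (hbL : ∀ l, b l ∈ L)
    (hab : ∀ l l', ⟪a l, b l'⟫ = if l = l' then ρ l else 0) (hρ : Antitone ρ)
    (hpos : ∀ l, 0 < ρ l) :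
    ∃ x y, IsUnitOrthogonal K u i x ∧ IsUnitOrthogonal L v i y ∧ ρ ⟨i, hi⟩ ≤ ⟪x, y⟫ := by
  set e : Fin (i + 1) → Fin m := Fin.castLE hi
  have heinj : Function.Injective e := Fin.castLE_injective hi
  have ha' : Orthonormal ℝ (a ∘ e) := ha.comp e heinj
  have hb' : Orthonormal ℝ (b ∘ e) := hb.comp e heinj
  -- a nonzero `x` in the span of `a 0, …, a i`, orthogonal to `u 0, …, u (i - 1)`
  obtain ⟨c, hc0, hc⟩ := exists_ne_zero_forall_dual_eq_zero (i := i)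
    (fun j => ∑ l, ⟪a (e l), u j⟫ • LinearMap.proj l)
  set x : H := ∑ l, c l • (a ∘ e) l with hx
  have hxK : x ∈ K := K.sum_mem fun l _ => K.smul_mem _ (haK _)
  have hxu : ∀ j < i, ⟪x, u j⟫ = 0 := fun j hj => by
    have := hc ⟨j, hj⟩
    simp only [LinearMap.sum_apply, LinearMap.smul_apply, LinearMap.proj_apply, smul_eq_mul] at this
    rw [hx, sum_inner, ← this]
    exact Finset.sum_congr rfl fun l _ => by
      rw [real_inner_smul_left, Function.comp_apply, mul_comm]
  have hxn : ‖x‖ ^ 2 = ∑ l, c l ^ 2 := by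
    rw [← real_inner_self_eq_norm_sq, hx, ha'.inner_sum]
    simp [sq]
  have hxpos : 0 < ‖x‖ := by
    have : 0 < ‖x‖ ^ 2 := by
      rw [hxn]
      obtain ⟨l, hl⟩ := Function.ne_iff.1 hc0
      exact Finset.sum_pos' (fun _ _ => sq_nonneg _) ⟨l, Finset.mem_univ _, by
        have : c l ≠ 0 := hl
        positivity⟩
    exact lt_of_pow_lt_pow_left₀ 2 (norm_nonneg _) (by simpa using this)
  -- `w` is the projection of `x` on the span of the `b l`
  set w : H := ∑ l, (c l * ρ (e l)) • (b ∘ e) l with hw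
  have hwL : w ∈ L := L.sum_mem fun l _ => L.smul_mem _ (hbL _)
  have hwn : ‖w‖ ^ 2 = ∑ l, c l ^ 2 * ρ (e l) ^ 2 := by
    rw [← real_inner_self_eq_norm_sq, hw, hb'.inner_sum]
    exact Finset.sum_congr rfl fun l _ => by simp; ring
  have hxw : ⟪x, w⟫ = ‖w‖ ^ 2 := by
    rw [hwn, hx, hw, sum_inner]
    refine Finset.sum_congr rfl fun l _ => ?_
    rw [inner_sum, Finset.sum_eq_single l]
    · rw [real_inner_smul_left, real_inner_smul_right, Function.comp_apply, Function.comp_apply,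
        hab, if_pos rfl]; ring
    · intro l' _ hl'
      rw [real_inner_smul_left, real_inner_smul_right, Function.comp_apply, Function.comp_apply,
        hab, if_neg (fun h => hl' (heinj h).symm)]; ring
    · simp
  have hρi := hpos ⟨i, hi⟩
  have hwx : ρ ⟨i, hi⟩ * ‖x‖ ≤ ‖w‖ := by
    refine le_of_sq_le_sq ?_ (norm_nonneg _)
    rw [mul_pow, hxn, hwn, Finset.mul_sum]
    refine Finset.sum_le_sum fun l _ => ?_
    rw [mul_comm]
    refine mul_le_mul_of_nonneg_left ?_ (sq_nonneg _)
    refine pow_le_pow_left₀ hρi.le (hρ ?_) 2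
    exact Fin.le_def.2 (Nat.lt_succ_iff.1 l.2)
  have hwpos : 0 < ‖w‖ := lt_of_lt_of_le (by positivity) hwx
  have hxv : ∀ j < i, ⟪x, v j⟫ = 0 := fun j hj =>
    h.inner_eq_zero hj hxK fun l hl => hxu l (hl.trans_lt hj)
  have hv : ∀ j < i, ∀ l < i, ⟪v j, v l⟫ = if j = l then 1 else 0 := by
    intro j hj l hl
    rcases lt_trichotomy j l with h' | h' | h'
    · rw [real_inner_comm, (h l hl).2.1.orthogonal j h', if_neg h'.ne]
    · rw [h', real_inner_self_eq_norm_sq, (h l hl).2.1.norm_eq_one]; simp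
    · rw [(h j hj).2.1.orthogonal l h', if_neg h'.ne']
  -- Removing from `w` its component `q` along the earlier `v j` does not lengthen it, and preserves
  -- its inner product with `x`, because `x` is orthogonal to these `v j`.
  set q : H := ∑ j ∈ Finset.range i, ⟪w, v j⟫ • v j with hq
  have hqL : q ∈ L := L.sum_mem fun j hj =>
    L.smul_mem _ (h j (Finset.mem_range.1 hj)).2.1.mem
  have hqv : ∀ j < i, ⟪q, v j⟫ = ⟪w, v j⟫ := fun j hj => by
    rw [hq, sum_inner, Finset.sum_eq_single j]
    · rw [real_inner_smul_left, hv j hj j hj, if_pos rfl, mul_one]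
    · intro l hl hlj
      rw [real_inner_smul_left, hv l (Finset.mem_range.1 hl) j hj, if_neg hlj, mul_zero]
    · intro hj'; exact absurd (Finset.mem_range.2 hj) hj'
  have hyv : ∀ j < i, ⟪w - q, v j⟫ = 0 := fun j hj => by
    rw [inner_sub_left, hqv j hj, sub_self]
  have hxq : ⟪x, q⟫ = 0 := by
    rw [hq, inner_sum]
    exact Finset.sum_eq_zero fun j hj => by
      rw [real_inner_smul_right, hxv j (Finset.mem_range.1 hj), mul_zero]
  have hxy : ⟪x, w - q⟫ = ‖w‖ ^ 2 := by rw [inner_sub_right, hxq, hxw, sub_zero]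
  have hqy : ⟪w - q, q⟫ = 0 := by
    conv_lhs => rw [hq, inner_sum]
    exact Finset.sum_eq_zero fun j hj => by
      rw [real_inner_smul_right, hyv j (Finset.mem_range.1 hj), mul_zero]
  have hyn : ‖w - q‖ ≤ ‖w‖ := by
    refine le_of_sq_le_sq ?_ (norm_nonneg _)
    have : ‖w‖ ^ 2 = ‖w - q‖ ^ 2 + ‖q‖ ^ 2 := by
      conv_lhs => rw [← sub_add_cancel w q]
      rw [norm_add_sq_real, hqy]; ring
    nlinarith [sq_nonneg ‖q‖]
  have hy0 : w - q ≠ 0 := by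
    intro h0
    rw [h0, inner_zero_right] at hxy
    exact absurd hxy.symm (by positivity)
  have hypos : 0 < ‖w - q‖ := norm_pos_iff.2 hy0
  refine ⟨_, _, IsUnitOrthogonal.normalize hxK (norm_pos_iff.1 hxpos) hxu,
    IsUnitOrthogonal.normalize (L.sub_mem hwL hqL) hy0 hyv, ?_⟩
  rw [real_inner_smul_left, real_inner_smul_right, hxy, ← mul_assoc, ← mul_inv,
    inv_mul_eq_div, le_div_iff₀ (by positivity)]
  calc ρ ⟨i, hi⟩ * (‖x‖ * ‖w - q‖) = (ρ ⟨i, hi⟩ * ‖x‖) * ‖w - q‖ := by ring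
    _ ≤ ‖w‖ * ‖w‖ := mul_le_mul hwx hyn (norm_nonneg _) (norm_nonneg _)
    _ = ‖w‖ ^ 2 := by ring

/-- Singular value decomposition of the form `(x, y) ↦ ⟪f x, g y⟫`, restricted to the positive
singular values. The vectors `f (w i)` and `g (z i)` are the singular vectors of the orthogonal
projection from the range of `f` to the range of `g`. -/
lemma exists_singular_vectors {E F : Type*} [AddCommGroup E] [Module ℝ E] [FiniteDimensional ℝ E]
    [AddCommGroup F] [Module ℝ F] [FiniteDimensional ℝ F] (f : E →ₗ[ℝ] H) (g : F →ₗ[ℝ] H) :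
    ∃ m : ℕ, m ≤ Module.finrank ℝ E ∧ m ≤ Module.finrank ℝ F ∧
    ∃ (w : Fin m → E) (z : Fin m → F) (ρ : Fin m → ℝ), Antitone ρ ∧ (∀ i, 0 < ρ i) ∧
      Orthonormal ℝ (f ∘ w) ∧ Orthonormal ℝ (g ∘ z) ∧
      ∀ x y, ⟪f x, g y⟫ = ∑ i, ρ i * ⟪f x, f (w i)⟫ * ⟪g (z i), g y⟫ := by
  -- `T` is the orthogonal projection onto `L`, restricted to `K`
  set K := LinearMap.range f
  set L := LinearMap.range g
  set T : K →ₗ[ℝ] L := L.orthogonalProjectionOnto.toLinearMap ∘ₗ K.subtype with hT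
  have hTin : ∀ (x : K) (y : L), ⟪T x, y⟫ = ⟪(x : H), (y : H)⟫ := fun x y => by
    simp [hT]
  set n := Module.finrank ℝ K with hn
  set e := T.isSymmetric_adjoint_comp_self.eigenvectorBasis hn.symm with he
  set m := Module.finrank ℝ (LinearMap.range T) with hm
  have hmn : m ≤ n := T.finrank_range_le
  have hsq : ∀ i : Fin n, T.adjoint (T (e i)) = (T.singularValues i ^ 2) • e i := fun i => by
    have := T.isSymmetric_adjoint_comp_self.apply_eigenvectorBasis hn.symm i
    rw [T.sq_singularValues_fin hn.symm]
    exact this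
  have hTT : ∀ i (y : K), ⟪T (e i), T y⟫ = T.singularValues i ^ 2 * ⟪e i, y⟫ := fun i y => by
    rw [← LinearMap.adjoint_inner_left, hsq, real_inner_smul_left]
  have hpos : ∀ i : Fin m, 0 < T.singularValues i := fun i =>
    T.singularValues_pos_iff_lt_finrank_range.2 i.2
  choose w hw using fun i : Fin m => (e (Fin.castLE hmn i)).2
  choose z hz using fun i : Fin m => ((T.singularValues i)⁻¹ • T (e (Fin.castLE hmn i))).2
  have hb : Orthonormal ℝ fun i : Fin m => (T.singularValues i)⁻¹ • T (e (Fin.castLE hmn i)) := by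
    rw [orthonormal_iff_ite]
    intro i j
    rw [real_inner_smul_left, real_inner_smul_right, hTT, orthonormal_iff_ite.1 e.orthonormal]
    simp only [Fin.castLE_inj]
    have := (hpos i).ne'
    split_ifs with hij
    · subst hij; simp; field_simp
    · simp
  refine ⟨m, hmn.trans (LinearMap.finrank_range_le f),
    (Submodule.finrank_le _).trans (LinearMap.finrank_range_le g), w, z,
    fun i => T.singularValues i, fun i j hij => T.singularValues_antitone hij, hpos, ?_, ?_, ?_⟩
  · have : f ∘ w = K.subtypeₗᵢ ∘ (e ∘ Fin.castLE hmn) := funext hw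
    rw [this]
    exact (e.orthonormal.comp _ (Fin.castLE_injective hmn)).comp_linearIsometry _
  · have : g ∘ z = L.subtypeₗᵢ ∘ fun i : Fin m =>
        (T.singularValues i)⁻¹ • T (e (Fin.castLE hmn i)) := funext hz
    rw [this]
    exact hb.comp_linearIsometry _
  · intro x y
    set x' : K := ⟨f x, x, rfl⟩
    set y' : L := ⟨g y, y, rfl⟩
    have h1 : ⟪f x, g y⟫ = ⟪T x', y'⟫ := (hTin x' y').symm
    have h2 : T x' = ∑ i : Fin n, ⟪e i, x'⟫ • T (e i) := by
      conv_lhs => rw [← e.sum_repr x', map_sum]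
      simp [e.repr_apply_apply]
    have h0 : ∀ i : Fin n, ¬ (i : ℕ) < m → T (e i) = 0 := fun i hi => by
      have : T.singularValues i = 0 :=
        T.singularValues_eq_zero_iff_le_finrank_range.2 (not_lt.1 hi)
      have h3 := hTT i (e i)
      rw [this] at h3
      simpa using h3
    rw [h1, h2, sum_inner]
    symm
    refine Finset.sum_of_injOn (Fin.castLE hmn) (Fin.castLE_injective hmn).injOn (by simp) ?_ ?_
    · intro i _ hi
      rw [h0 i, smul_zero, inner_zero_left]
      exact fun h => hi ⟨⟨i, h⟩, by simp, rfl⟩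
    · intro i _
      have h4 : ⟪f x, f (w i)⟫ = ⟪e (Fin.castLE hmn i), x'⟫ := by
        rw [hw, real_inner_comm]; rfl
      have h5 : ⟪g (z i), g y⟫ = (T.singularValues i)⁻¹ * ⟪T (e (Fin.castLE hmn i)), y'⟫ := by
        rw [hz, ← real_inner_smul_left]; rfl
      rw [h4, h5, real_inner_smul_left]
      have := (hpos i).ne'
      field_simp

end HilbertSpace

/-! ### Mutual information of independent pieces -/

section MutualInformation

open InformationTheory

lemma klDiv_prod_le {α β : Type*} [MeasurableSpace α] [MeasurableSpace β] (μ₁ ν₁ : Measure α)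
    (μ₂ ν₂ : Measure β) [IsProbabilityMeasure μ₁] [IsProbabilityMeasure ν₁]
    [IsProbabilityMeasure μ₂] [IsProbabilityMeasure ν₂] :
    klDiv (μ₁.prod μ₂) (ν₁.prod ν₂) ≤ klDiv μ₁ ν₁ + klDiv μ₂ ν₂ := by
  rw [← Measure.compProd_const, ← Measure.compProd_const, klDiv_compProd_eq_add]
  gcongr
  rw [Measure.compProd_const, Measure.compProd_const]
  calc klDiv (μ₁.prod μ₂) (μ₁.prod ν₂)
      = klDiv ((μ₂.prod μ₁).map Prod.swap) ((ν₂.prod μ₁).map Prod.swap) := by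
        rw [Measure.prod_swap, Measure.prod_swap]
    _ ≤ klDiv (μ₂.prod μ₁) (ν₂.prod μ₁) := klDiv_map_le _ _ measurable_swap
    _ = klDiv μ₂ ν₂ := by
        rw [← Measure.compProd_const, ← Measure.compProd_const, klDiv_compProd_left]

variable {Ω E F E' F' : Type*} [MeasurableSpace Ω] [MeasurableSpace E] [MeasurableSpace F]
  [MeasurableSpace E'] [MeasurableSpace F'] {P : Measure Ω} [IsProbabilityMeasure P]

/-- The data processing inequality for the mutual information. -/
lemma mutualInfo_comp_le {A : Ω → E} {B : Ω → F} (hA : AEMeasurable A P) (hB : AEMeasurable B P)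
    {f : E → E'} {g : F → F'} (hf : Measurable f) (hg : Measurable g) :
    mutualInfo P (fun ω => f (A ω)) (fun ω => g (B ω)) ≤ mutualInfo P A B := by
  have := Measure.isProbabilityMeasure_map hA
  have := Measure.isProbabilityMeasure_map hB
  have := Measure.isProbabilityMeasure_map (hA.prodMk hB)
  have h1 : P.map (fun ω => (f (A ω), g (B ω))) =
      (P.map fun ω => (A ω, B ω)).map (Prod.map f g) :=
    (AEMeasurable.map_map_of_aemeasurable (hf.prodMap hg).aemeasurable (hA.prodMk hB)).symm
  have h2 : P.map (fun ω => f (A ω)) = (P.map A).map f :=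
    (AEMeasurable.map_map_of_aemeasurable hf.aemeasurable hA).symm
  have h3 : P.map (fun ω => g (B ω)) = (P.map B).map g :=
    (AEMeasurable.map_map_of_aemeasurable hg.aemeasurable hB).symm
  rw [mutualInfo, mutualInfo, h1, h2, h3, Measure.map_prod_map _ _ hf hg]
  exact klDiv_map_le _ _ (hf.prodMap hg)

lemma mutualInfo_eq_zero {A : Ω → E} {B : Ω → F} (hA : AEMeasurable A P) (hB : AEMeasurable B P)
    (h : IndepFun A B P) : mutualInfo P A B = 0 := by
  have := Measure.isProbabilityMeasure_map hA
  have := Measure.isProbabilityMeasure_map hB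
  rw [mutualInfo, (indepFun_iff_map_prod_eq_prod_map_map hA hB).1 h, klDiv_self]

/-- Subadditivity of the mutual information for independent pairs `(a, b)` and `(A, B)`: after a
permutation of the coordinates, both measures compared are products. -/
lemma mutualInfo_prodMk_le {a : Ω → E} {b : Ω → F} {A : Ω → E'} {B : Ω → F'}
    (ha : AEMeasurable a P) (hb : AEMeasurable b P) (hA : AEMeasurable A P) (hB : AEMeasurable B P)
    (h : IndepFun (fun ω => (a ω, b ω)) (fun ω => (A ω, B ω)) P) :
    mutualInfo P (fun ω => (a ω, A ω)) (fun ω => (b ω, B ω)) ≤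
      mutualInfo P a b + mutualInfo P A B := by
  have := Measure.isProbabilityMeasure_map ha
  have := Measure.isProbabilityMeasure_map hb
  have := Measure.isProbabilityMeasure_map hA
  have := Measure.isProbabilityMeasure_map hB
  have := Measure.isProbabilityMeasure_map (ha.prodMk hb)
  have := Measure.isProbabilityMeasure_map (hA.prodMk hB)
  set s : (E × F) × (E' × F') → (E × E') × (F × F') := fun p => ((p.1.1, p.2.1), (p.1.2, p.2.2))
  have hs : Measurable s := by fun_prop
  have haA : IndepFun a A P := h.comp measurable_fst measurable_fst
  have hbB : IndepFun b B P := h.comp measurable_snd measurable_snd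
  have h1 : P.map (fun ω => ((a ω, A ω), (b ω, B ω))) =
      ((P.map fun ω => (a ω, b ω)).prod (P.map fun ω => (A ω, B ω))).map s := by
    rw [← (indepFun_iff_map_prod_eq_prod_map_map (ha.prodMk hb) (hA.prodMk hB)).1 h,
      AEMeasurable.map_map_of_aemeasurable hs.aemeasurable ((ha.prodMk hb).prodMk (hA.prodMk hB))]
    rfl
  have h2 : (P.map fun ω => (a ω, A ω)).prod (P.map fun ω => (b ω, B ω)) =
      (((P.map a).prod (P.map b)).prod ((P.map A).prod (P.map B))).map s := by
    rw [(indepFun_iff_map_prod_eq_prod_map_map ha hA).1 haA,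
      (indepFun_iff_map_prod_eq_prod_map_map hb hB).1 hbB]
    refine Measure.ext_of_lintegral _ fun φ hφ => ?_
    rw [lintegral_map hφ hs, lintegral_prod _ (by fun_prop), lintegral_prod _ (by fun_prop),
      lintegral_prod _ (by fun_prop), lintegral_prod _ (by fun_prop)]
    refine lintegral_congr fun x => ?_
    rw [lintegral_lintegral_swap (by fun_prop), lintegral_prod _ (by fun_prop)]
    refine lintegral_congr fun y => ?_
    rw [lintegral_prod_symm _ (by fun_prop)]
  rw [mutualInfo, mutualInfo, mutualInfo, h1, h2]
  exact (klDiv_map_le _ _ hs).trans (klDiv_prod_le _ _ _ _)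

end MutualInformation

/-! ### The bivariate normal law -/

section Gaussian

/-- The logarithm of the density of the bivariate normal law with standard normal marginals and
correlation `ρ`, with respect to the product of its marginals, for `ρ ^ 2 < 1`. -/
def gaussianPairLogDensity (ρ : ℝ) (p : ℝ × ℝ) : ℝ :=
  -(1 / 2) * Real.log (1 - ρ ^ 2) - (p.2 - ρ * p.1) ^ 2 / (2 * (1 - ρ ^ 2)) + p.2 ^ 2 / 2

lemma measurable_gaussianPairLogDensity (ρ : ℝ) : Measurable (gaussianPairLogDensity ρ) := by
  unfold gaussianPairLogDensity; fun_prop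

lemma gaussianReal_eq_withDensity_exp {ρ : ℝ} (hρ : 0 < 1 - ρ ^ 2) (x : ℝ) :
    gaussianReal (ρ * x) (1 - ρ ^ 2).toNNReal = (gaussianReal 0 1).withDensity
      (fun y => ENNReal.ofReal (Real.exp (gaussianPairLogDensity ρ (x, y)))) := by
  have hv : (1 - ρ ^ 2).toNNReal ≠ 0 := by simpa using hρ
  rw [gaussianReal_of_var_ne_zero _ hv, gaussianReal_of_var_ne_zero _ one_ne_zero,
    ← withDensity_mul _ (measurable_gaussianPDF 0 1)
      (by have := measurable_gaussianPairLogDensity ρ; fun_prop)]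
  congr 1
  ext y
  rw [Pi.mul_apply, gaussianPDF, gaussianPDF, ← ENNReal.ofReal_mul (gaussianPDFReal_nonneg _ _ _)]
  congr 1
  rw [gaussianPDFReal, gaussianPDFReal, Real.coe_toNNReal _ hρ.le, gaussianPairLogDensity]
  have h1 : (√(2 * Real.pi * (1 - ρ ^ 2)))⁻¹ =
      (√(2 * Real.pi))⁻¹ * Real.exp (-(1 / 2) * Real.log (1 - ρ ^ 2)) := by
    rw [Real.sqrt_mul (by positivity), mul_inv]
    congr 1
    rw [mul_comm, Real.exp_mul, Real.exp_log hρ, Real.sqrt_eq_rpow, ← Real.rpow_neg hρ.le]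
  rw [h1, mul_assoc, mul_assoc, ← Real.exp_add, ← Real.exp_add]
  simp only [NNReal.coe_one, mul_one]
  congr 2
  ring

lemma map_prod_gaussianReal_eq_withDensity {ρ : ℝ} (hρ : 0 < 1 - ρ ^ 2) :
    ((gaussianReal 0 1).prod (gaussianReal 0 1)).map
      (fun p : ℝ × ℝ => (p.1, ρ * p.1 + √(1 - ρ ^ 2) * p.2)) =
    ((gaussianReal 0 1).prod (gaussianReal 0 1)).withDensity
      (fun p => ENNReal.ofReal (Real.exp (gaussianPairLogDensity ρ p))) := by
  have hg := measurable_gaussianPairLogDensity ρ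
  refine Measure.ext_of_lintegral _ fun φ hφ => ?_
  rw [lintegral_map hφ (by fun_prop), lintegral_withDensity_eq_lintegral_mul _ (by fun_prop) hφ,
    lintegral_prod _ (by fun_prop), lintegral_prod _ (by fun_prop)]
  refine lintegral_congr fun x => ?_
  have h1 : (gaussianReal 0 1).map (fun y => ρ * x + √(1 - ρ ^ 2) * y) =
      gaussianReal (ρ * x) (1 - ρ ^ 2).toNNReal := by
    have : (fun y => ρ * x + √(1 - ρ ^ 2) * y) =
        (fun y => ρ * x + y) ∘ (fun y => √(1 - ρ ^ 2) * y) := rfl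
    rw [this, ← Measure.map_map (by fun_prop) (by fun_prop), gaussianReal_map_const_mul,
      gaussianReal_map_const_add]
    congr 1
    · simp
    · ext
      simp [Real.sq_sqrt hρ.le, hρ.le]
  change _ = ∫⁻ y, ((fun y => ENNReal.ofReal (Real.exp (gaussianPairLogDensity ρ (x, y)))) *
    fun y => φ (x, y)) y ∂gaussianReal 0 1
  rw [← lintegral_withDensity_eq_lintegral_mul _ (by fun_prop) (by fun_prop),
    ← gaussianReal_eq_withDensity_exp hρ, ← h1, lintegral_map (by fun_prop) (by fun_prop)]

variable {Ω : Type*} [MeasurableSpace Ω] {P : Measure Ω}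

lemma map_eq_gaussianReal_zero_one {a : Ω → ℝ} (ha : HasGaussianLaw a P)
    (h0 : ∫ ω, a ω ∂P = 0) (h1 : cov[a, a; P] = 1) : P.map a = gaussianReal 0 1 := by
  rw [ha.map_eq_gaussianReal, h0, ← covariance_self ha.aemeasurable, h1, Real.toNNReal_one]

variable [IsProbabilityMeasure P]

lemma mutualInfo_gaussian_pair_le_of_centered {a b : Ω → ℝ} {ρ : ℝ}
    (hab : HasGaussianLaw (fun ω => (a ω, b ω)) P) (ha0 : ∫ ω, a ω ∂P = 0)
    (hb0 : ∫ ω, b ω ∂P = 0) (ha : cov[a, a; P] = 1) (hb : cov[b, b; P] = 1)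
    (hc : cov[a, b; P] = ρ) (hρ : 0 < 1 - ρ ^ 2) :
    mutualInfo P a b ≤ ENNReal.ofReal (-(1 / 2) * Real.log (1 - ρ ^ 2)) := by
  have ha2 := hab.fst.memLp_two
  have hb2 := hab.snd.memLp_two
  set c := √(1 - ρ ^ 2) with hcdef
  have hc0 : 0 < c := Real.sqrt_pos.2 hρ
  have hcc : c ^ 2 = 1 - ρ ^ 2 := Real.sq_sqrt hρ.le
  -- `(a, b)` is a linear image of the pair `(a, n)` of independent standard normal variables
  set n : Ω → ℝ := fun ω => c⁻¹ * (b ω - ρ * a ω) with hn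
  have hn2 : MemLp n 2 P := (hb2.sub (ha2.const_mul ρ)).const_mul c⁻¹
  have hd2 : MemLp (fun ω => b ω - ρ * a ω) 2 P := hb2.sub (ha2.const_mul ρ)
  have han : HasGaussianLaw (fun ω => (a ω, n ω)) P := by
    have := hab.map_fun ((ContinuousLinearMap.fst ℝ ℝ ℝ).prod
      (c⁻¹ • (ContinuousLinearMap.snd ℝ ℝ ℝ - ρ • ContinuousLinearMap.fst ℝ ℝ ℝ)))
    simpa using this
  have hcovd : cov[a, fun ω => b ω - ρ * a ω; P] = 0 := by
    rw [covariance_fun_sub_right ha2 hb2 (ha2.const_mul ρ), covariance_const_mul_right, ha, hc]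
    ring
  have hcov : cov[a, n; P] = 0 := by
    rw [hn, covariance_const_mul_right, hcovd, mul_zero]
  have hvard : cov[fun ω => b ω - ρ * a ω, fun ω => b ω - ρ * a ω; P] = c ^ 2 := by
    rw [covariance_fun_sub_left hb2 (ha2.const_mul ρ) hd2, covariance_const_mul_left, hcovd,
      covariance_fun_sub_right hb2 hb2 (ha2.const_mul ρ), covariance_const_mul_right, hb,
      covariance_comm, hc, hcc]
    ring
  have hvar : cov[n, n; P] = 1 := by
    rw [hn, covariance_const_mul_right, covariance_const_mul_left, hvard]
    field_simp
  have hind : IndepFun a n P := han.indepFun_of_covariance_eq_zero hcov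
  have hd0 : ∫ ω, b ω - ρ * a ω ∂P = 0 := by
    rw [integral_sub (hb2.integrable one_le_two) ((ha2.const_mul ρ).integrable one_le_two),
      integral_const_mul, ha0, hb0]; simp
  have hn0 : ∫ ω, n ω ∂P = 0 := by rw [hn, integral_const_mul, hd0, mul_zero]
  have hlaw : P.map (fun ω => (a ω, b ω)) = ((gaussianReal 0 1).prod (gaussianReal 0 1)).withDensity
      (fun p => ENNReal.ofReal (Real.exp (gaussianPairLogDensity ρ p))) := by
    rw [← map_prod_gaussianReal_eq_withDensity hρ]
    have h1 := (indepFun_iff_map_prod_eq_prod_map_map ha2.aemeasurable hn2.aemeasurable).1 hind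
    rw [map_eq_gaussianReal_zero_one han.fst ha0 ha,
      map_eq_gaussianReal_zero_one han.snd hn0 hvar] at h1
    rw [← h1, AEMeasurable.map_map_of_aemeasurable (by fun_prop) han.aemeasurable]
    congr 1
    ext ω
    · rfl
    · simp only [Function.comp_apply, hn]
      field_simp
      ring
  have hg := measurable_gaussianPairLogDensity ρ
  rw [mutualInfo, map_eq_gaussianReal_zero_one hab.fst ha0 ha,
      map_eq_gaussianReal_zero_one hab.snd hb0 hb]
  have hprob : IsProbabilityMeasure (P.map fun ω => (a ω, b ω)) :=
    Measure.isProbabilityMeasure_map hab.aemeasurable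
  have hac : P.map (fun ω => (a ω, b ω)) ≪ (gaussianReal 0 1).prod (gaussianReal 0 1) := by
    rw [hlaw]; exact withDensity_absolutelyContinuous _ _
  have hllr : llr (P.map fun ω => (a ω, b ω)) ((gaussianReal 0 1).prod (gaussianReal 0 1))
      =ᵐ[P.map fun ω => (a ω, b ω)] gaussianPairLogDensity ρ := by
    have h1 := hac.ae_le (Measure.rnDeriv_withDensity ((gaussianReal 0 1).prod (gaussianReal 0 1))
      (f := fun p => ENNReal.ofReal (Real.exp (gaussianPairLogDensity ρ p))) (by fun_prop))
    rw [← hlaw] at h1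
    filter_upwards [h1] with p hp
    rw [llr, hp, ENNReal.toReal_ofReal (Real.exp_pos _).le, Real.log_exp]
  have hid : Integrable (fun ω => (b ω - ρ * a ω) ^ 2 / (2 * (1 - ρ ^ 2))) P :=
    hd2.integrable_sq.div_const _
  have hib : Integrable (fun ω => b ω ^ 2 / 2) P := hb2.integrable_sq.div_const _
  have his : Integrable (fun ω => -(1 / 2) * Real.log (1 - ρ ^ 2) -
      (b ω - ρ * a ω) ^ 2 / (2 * (1 - ρ ^ 2))) P := (integrable_const _).sub hid
  have hint : Integrable (fun ω => gaussianPairLogDensity ρ (a ω, b ω)) P := his.add hib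
  have hint' : Integrable (gaussianPairLogDensity ρ) (P.map fun ω => (a ω, b ω)) :=
    (integrable_map_measure hg.aestronglyMeasurable hab.aemeasurable).2 hint
  have hval : ∫ ω, gaussianPairLogDensity ρ (a ω, b ω) ∂P = -(1 / 2) * Real.log (1 - ρ ^ 2) := by
    have hb' : ∫ ω, b ω ^ 2 ∂P = 1 := by
      rw [← hb, covariance_eq_sub hb2 hb2, hb0]
      simp [sq]
    have hd' : ∫ ω, (b ω - ρ * a ω) ^ 2 ∂P = 1 - ρ ^ 2 := by
      rw [← hcc, ← hvard, covariance_eq_sub hd2 hd2, hd0]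
      simp [sq]
    simp only [gaussianPairLogDensity]
    rw [integral_add his hib, integral_sub (integrable_const _) hid, integral_div, integral_div,
      hb', hd']
    simp only [integral_const, probReal_univ, smul_eq_mul, one_mul]
    field_simp
    ring
  rw [InformationTheory.klDiv_of_ac_of_integrable hac (hint'.congr hllr.symm),
    integral_congr_ae hllr, integral_map hab.aemeasurable hg.aestronglyMeasurable, hval]
  simp

lemma mutualInfo_gaussian_pair_le {a b : Ω → ℝ} {ρ : ℝ}
    (hab : HasGaussianLaw (fun ω => (a ω, b ω)) P) (ha : cov[a, a; P] = 1)
    (hb : cov[b, b; P] = 1) (hc : cov[a, b; P] = ρ) (hρ : 0 < 1 - ρ ^ 2) :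
    mutualInfo P a b ≤ ENNReal.ofReal (-(1 / 2) * Real.log (1 - ρ ^ 2)) := by
  have ha1 := hab.fst.integrable
  have hb1 := hab.snd.integrable
  have h1 : mutualInfo P a b ≤
      mutualInfo P (fun ω => a ω - ∫ ω, a ω ∂P) (fun ω => b ω - ∫ ω, b ω ∂P) := by
    have := mutualInfo_comp_le (P := P) (A := fun ω => a ω - ∫ ω, a ω ∂P)
      (B := fun ω => b ω - ∫ ω, b ω ∂P) (by fun_prop) (by fun_prop)
      (f := fun x => x + ∫ ω, a ω ∂P) (g := fun x => x + ∫ ω, b ω ∂P) (by fun_prop) (by fun_prop)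
    simpa using this
  refine h1.trans (mutualInfo_gaussian_pair_le_of_centered ?_ ?_ ?_ ?_ ?_ ?_ hρ)
  · have := hab.isGaussian_map
    have h2 : IsGaussian ((P.map fun ω => (a ω, b ω)).map
      fun p => p - (∫ ω, a ω ∂P, ∫ ω, b ω ∂P)) := inferInstance
    rw [AEMeasurable.map_map_of_aemeasurable (by fun_prop) hab.aemeasurable] at h2
    exact ⟨h2⟩
  · rw [integral_sub ha1 (integrable_const _)]; simp
  · rw [integral_sub hb1 (integrable_const _)]; simp
  · rw [covariance_sub_const_left ha1, covariance_sub_const_right ha1, ha]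
  · rw [covariance_sub_const_left hb1, covariance_sub_const_right hb1, hb]
  · rw [covariance_sub_const_left ha1, covariance_sub_const_right hb1, hc]

end Gaussian

/-! ### Jointly normal vectors -/

section GaussianVector

variable {Ω E F : Type*} [MeasurableSpace Ω] {P : Measure Ω} [IsProbabilityMeasure P]
  [NormedAddCommGroup E] [InnerProductSpace ℝ E] [CompleteSpace E] [SecondCountableTopology E]
  [MeasurableSpace E] [BorelSpace E]
  [NormedAddCommGroup F] [InnerProductSpace ℝ F] [CompleteSpace F] [SecondCountableTopology F]
  [MeasurableSpace F] [BorelSpace F]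

omit [SecondCountableTopology E] [BorelSpace E] [MeasurableSpace E] in
/-- The covariance of a vector `A` with a scalar `a`, as a vector. -/
lemma exists_inner_eq_covariance {A : Ω → E} (hA : MemLp A 2 P) {a : Ω → ℝ} (ha : MemLp a 2 P) :
    ∃ α : E, ∀ x, ⟪x, α⟫ = cov[fun ω => ⟪x, A ω⟫, a; P] := by
  have hint : Integrable (fun ω => (a ω - ∫ ω, a ω ∂P) • A ω) P :=
    memLp_one_iff_integrable.1 (hA.smul (ha.sub (memLp_const _)))
  refine ⟨∫ ω, (a ω - ∫ ω, a ω ∂P) • A ω ∂P, fun x => ?_⟩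
  rw [← integral_inner hint, ← covariance_sub_const_right (ha.integrable one_le_two)
    (∫ ω, a ω ∂P), covariance_eq_sub (hA.const_inner x)
    (show MemLp (fun ω => a ω - ∫ ω, a ω ∂P) 2 P from ha.sub (memLp_const _))]
  have : ∫ ω, (a ω - ∫ ω, a ω ∂P) ∂P = 0 := by
    rw [integral_sub (ha.integrable one_le_two) (integrable_const _)]; simp
  rw [this, mul_zero, sub_zero]
  refine integral_congr_ae (ae_of_all _ fun ω => ?_)
  simp [real_inner_smul_right, mul_comm]

/-- The mutual information of a jointly normal pair of vectors with canonical correlations `ρ i`.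
In the inductive step `a = ⟪w 0, A⟫` and `b = ⟪z 0, B⟫` are split off; the residuals `A'`, `B'` of
the linear regressions of `A` on `a` and of `B` on `b` are jointly independent of `(a, b)`, and have
the remaining canonical correlations. -/
lemma mutualInfo_le_sum_of_gaussian (m : ℕ) : ∀ (A : Ω → E) (B : Ω → F) (w : Fin m → E)
    (z : Fin m → F) (ρ : Fin m → ℝ), HasGaussianLaw (fun ω => (A ω, B ω)) P →
    (∀ i, 0 < 1 - ρ i ^ 2) →
    (∀ i j, cov[fun ω => ⟪w i, A ω⟫, fun ω => ⟪w j, A ω⟫; P] = if i = j then 1 else 0) →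
    (∀ i j, cov[fun ω => ⟪z i, B ω⟫, fun ω => ⟪z j, B ω⟫; P] = if i = j then 1 else 0) →
    (∀ x y, cov[fun ω => ⟪x, A ω⟫, fun ω => ⟪y, B ω⟫; P] =
      ∑ i, ρ i * cov[fun ω => ⟪x, A ω⟫, fun ω => ⟪w i, A ω⟫; P] *
        cov[fun ω => ⟪y, B ω⟫, fun ω => ⟪z i, B ω⟫; P]) →
    mutualInfo P A B ≤ ∑ i, ENNReal.ofReal (-(1 / 2) * Real.log (1 - ρ i ^ 2)) := by
  induction m with
  | zero =>
    intro A B w z ρ hAB _ _ _ hcov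
    have : IndepFun A B P := hAB.indepFun_of_covariance_inner fun x y => by
      rw [hcov]; simp
    rw [mutualInfo_eq_zero hAB.fst.aemeasurable hAB.snd.aemeasurable this]
    exact zero_le
  | succ m ih =>
    intro A B w z ρ hAB hρ hA hB hcov
    have hA2 := hAB.fst.memLp_two
    have hB2 := hAB.snd.memLp_two
    have hAx : ∀ x, MemLp (fun ω => ⟪x, A ω⟫) 2 P := fun x => hA2.const_inner x
    have hBy : ∀ y, MemLp (fun ω => ⟪y, B ω⟫) 2 P := fun y => hB2.const_inner y
    have hAm := hAB.fst.aemeasurable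
    have hBm := hAB.snd.aemeasurable
    set a : Ω → ℝ := fun ω => ⟪w 0, A ω⟫ with ha
    set b : Ω → ℝ := fun ω => ⟪z 0, B ω⟫ with hb
    have ha2 : MemLp a 2 P := hAx _
    have hb2 : MemLp b 2 P := hBy _
    obtain ⟨α, hα⟩ := exists_inner_eq_covariance hA2 ha2
    obtain ⟨β, hβ⟩ := exists_inner_eq_covariance hB2 hb2
    have haa : cov[a, a; P] = 1 := by simpa using hA 0 0
    have hbb : cov[b, b; P] = 1 := by simpa using hB 0 0
    have hxb : ∀ x, cov[fun ω => ⟪x, A ω⟫, b; P] = ρ 0 * ⟪x, α⟫ := fun x => by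
      rw [hb, hcov, Finset.sum_eq_single 0, hB, if_pos rfl, mul_one, hα]
      · intro i _ hi
        rw [hB, if_neg hi.symm, mul_zero]
      · simp
    have hay : ∀ y, cov[a, fun ω => ⟪y, B ω⟫; P] = ρ 0 * ⟪y, β⟫ := fun y => by
      rw [ha, hcov, Finset.sum_eq_single 0, hA, if_pos rfl, mul_one, hβ]
      · intro i _ hi
        rw [hA, if_neg hi.symm, mul_zero, zero_mul]
      · simp
    have hwα : ⟪w 0, α⟫ = 1 := by rw [hα, ← ha, haa]
    have hab : cov[a, b; P] = ρ 0 := by rw [ha, hxb, hwα, mul_one]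
    set A' : Ω → E := fun ω => A ω - a ω • α with hA'
    set B' : Ω → F := fun ω => B ω - b ω • β with hB'
    have hA'x : ∀ x, (fun ω => ⟪x, A' ω⟫) = fun ω => ⟪x, A ω⟫ - ⟪x, α⟫ * a ω := fun x => by
      ext ω; rw [hA', inner_sub_right, real_inner_smul_right, mul_comm]
    have hB'y : ∀ y, (fun ω => ⟪y, B' ω⟫) = fun ω => ⟪y, B ω⟫ - ⟪y, β⟫ * b ω := fun y => by
      ext ω; rw [hB', inner_sub_right, real_inner_smul_right, mul_comm]
    have hA'2 : ∀ x, MemLp (fun ω => ⟪x, A' ω⟫) 2 P := fun x => by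
      rw [hA'x]; exact (hAx x).sub (ha2.const_mul _)
    have hB'2 : ∀ y, MemLp (fun ω => ⟪y, B' ω⟫) 2 P := fun y => by
      rw [hB'y]; exact (hBy y).sub (hb2.const_mul _)
    -- the residuals are uncorrelated with the pair that has been split off
    have haA' : ∀ x, cov[fun ω => ⟪x, A' ω⟫, a; P] = 0 := fun x => by
      rw [hA'x, covariance_fun_sub_left (hAx x) (ha2.const_mul _) ha2, covariance_const_mul_left,
        haa, hα]; ring
    have hbA' : ∀ x, cov[fun ω => ⟪x, A' ω⟫, b; P] = 0 := fun x => by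
      rw [hA'x, covariance_fun_sub_left (hAx x) (ha2.const_mul _) hb2, covariance_const_mul_left,
        hab, hxb]; ring
    have hbB' : ∀ y, cov[fun ω => ⟪y, B' ω⟫, b; P] = 0 := fun y => by
      rw [hB'y, covariance_fun_sub_left (hBy y) (hb2.const_mul _) hb2, covariance_const_mul_left,
        hbb, hβ]; ring
    have haB' : ∀ y, cov[fun ω => ⟪y, B' ω⟫, a; P] = 0 := fun y => by
      rw [hB'y, covariance_fun_sub_left (hBy y) (hb2.const_mul _) ha2, covariance_const_mul_left,
        covariance_comm b, hab, covariance_comm, hay]; ring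
    have hjoint : HasGaussianLaw (fun ω => ((a ω, b ω), (A' ω, B' ω))) P := by
      have := hAB.map_fun ((((innerSL ℝ (w 0)).comp (.fst ℝ E F)).prod
        ((innerSL ℝ (z 0)).comp (.snd ℝ E F))).prod
        ((ContinuousLinearMap.fst ℝ E F - ((innerSL ℝ (w 0)).comp (.fst ℝ E F)).smulRight α).prod
        (ContinuousLinearMap.snd ℝ E F - ((innerSL ℝ (z 0)).comp (.snd ℝ E F)).smulRight β)))
      simpa using this
    have hind : IndepFun (fun ω => (a ω, b ω)) (fun ω => (A' ω, B' ω)) P := by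
      refine hjoint.indepFun_of_covariance_strongDual fun L₁ L₂ => ?_
      have h1 : L₁ ∘ (fun ω => (a ω, b ω)) = fun ω => L₁ (1, 0) * a ω + L₁ (0, 1) * b ω := by
        ext ω
        have : (a ω, b ω) = a ω • ((1 : ℝ), (0 : ℝ)) + b ω • ((0 : ℝ), (1 : ℝ)) := by simp
        rw [Function.comp_apply, this, map_add, map_smul, map_smul, smul_eq_mul, smul_eq_mul]
        ring
      have h2 : L₂ ∘ (fun ω => (A' ω, B' ω)) = fun ω =>
          ⟪(InnerProductSpace.toDual ℝ E).symm (L₂.comp (.inl ℝ E F)), A' ω⟫ +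
          ⟪(InnerProductSpace.toDual ℝ F).symm (L₂.comp (.inr ℝ E F)), B' ω⟫ := by
        ext ω
        rw [InnerProductSpace.toDual_symm_apply, InnerProductSpace.toDual_symm_apply]
        simp [← map_add]
      rw [h1, h2, covariance_comm]
      have h3 : ∀ f : Ω → ℝ, MemLp f 2 P → cov[f, a; P] = 0 → cov[f, b; P] = 0 →
          cov[f, (fun ω => L₁ (1, 0) * a ω) + fun ω => L₁ (0, 1) * b ω; P] = 0 :=
        fun f hf hfa hfb =>
        (covariance_add_right hf (ha2.const_mul _) (hb2.const_mul _)).trans (by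
          rw [covariance_const_mul_right, covariance_const_mul_right, hfa, hfb]; ring)
      refine (covariance_add_left (hA'2 _) (hB'2 _)
        ((ha2.const_mul _).add (hb2.const_mul _))).trans ?_
      rw [h3 _ (hA'2 _) (haA' _) (hbA' _), h3 _ (hB'2 _) (haB' _) (hbB' _), add_zero]
    have h1 : mutualInfo P A B ≤ mutualInfo P (fun ω => (a ω, A' ω)) (fun ω => (b ω, B' ω)) := by
      have := mutualInfo_comp_le (P := P) (A := fun ω => (a ω, A' ω)) (B := fun ω => (b ω, B' ω))
        (by fun_prop) (by fun_prop) (f := fun p => p.2 + p.1 • α) (g := fun p => p.2 + p.1 • β)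
        (by fun_prop) (by fun_prop)
      simpa [hA', hB'] using this
    have hw : ∀ i : Fin m, ⟪w i.succ, α⟫ = 0 := fun i => by
      rw [hα, ha, hA, if_neg (Fin.succ_ne_zero i)]
    have hz : ∀ i : Fin m, ⟪z i.succ, β⟫ = 0 := fun i => by
      rw [hβ, hb, hB, if_neg (Fin.succ_ne_zero i)]
    have hwA' : ∀ i : Fin m, (fun ω => ⟪w i.succ, A' ω⟫) = fun ω => ⟪w i.succ, A ω⟫ := fun i => by
      rw [hA'x, hw]; simp
    have hzB' : ∀ i : Fin m, (fun ω => ⟪z i.succ, B' ω⟫) = fun ω => ⟪z i.succ, B ω⟫ := fun i => by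
      rw [hB'y, hz]; simp
    have h2 : mutualInfo P A' B' ≤
        ∑ i : Fin m, ENNReal.ofReal (-(1 / 2) * Real.log (1 - ρ i.succ ^ 2)) := by
      refine ih A' B' (fun i => w i.succ) (fun i => z i.succ) (fun i => ρ i.succ) hjoint.snd
        (fun i => hρ _) ?_ ?_ ?_
      · intro i j
        rw [hwA', hwA', hA]; simp
      · intro i j
        rw [hzB', hzB', hB]; simp
      · intro x y
        have h3 : ∀ i : Fin m, cov[fun ω => ⟪x, A' ω⟫, fun ω => ⟪w i.succ, A' ω⟫; P] =
            cov[fun ω => ⟪x, A ω⟫, fun ω => ⟪w i.succ, A ω⟫; P] := fun i => by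
          rw [hwA', hA'x, covariance_fun_sub_left (hAx x) (ha2.const_mul _) (hAx _),
            covariance_const_mul_left, ha, hA, if_neg (Fin.succ_ne_zero i).symm]
          ring
        have h4 : ∀ i : Fin m, cov[fun ω => ⟪y, B' ω⟫, fun ω => ⟪z i.succ, B' ω⟫; P] =
            cov[fun ω => ⟪y, B ω⟫, fun ω => ⟪z i.succ, B ω⟫; P] := fun i => by
          rw [hzB', hB'y, covariance_fun_sub_left (hBy y) (hb2.const_mul _) (hBy _),
            covariance_const_mul_left, hb, hB, if_neg (Fin.succ_ne_zero i).symm]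
          ring
        simp only [h3, h4]
        rw [hB'y, covariance_fun_sub_right (hA'2 x) (hBy y) (hb2.const_mul _),
          covariance_const_mul_right, hbA', hA'x,
          covariance_fun_sub_left (hAx x) (ha2.const_mul _) (hBy y), covariance_const_mul_left,
          hay, hcov, Fin.sum_univ_succ, ← ha, ← hb, ← hα, ← hβ]
        ring
    rw [Fin.sum_univ_succ]
    exact h1.trans ((mutualInfo_prodMk_le (by fun_prop) (by fun_prop) hjoint.snd.fst.aemeasurable
      hjoint.snd.snd.aemeasurable hind).trans
      (add_le_add (mutualInfo_gaussian_pair_le hjoint.fst haa hbb hab (hρ 0)) h2))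

end GaussianVector

/-! ### Canonical pairs in `L²` -/

section SquareIntegrable

variable {Ω E F : Type*} [MeasurableSpace Ω] [MeasurableSpace E] [MeasurableSpace F]
  {P : Measure Ω} [IsProbabilityMeasure P] {X : Ω → E} {Y : Ω → F}

open Classical in
/-- The class of `g` in `L²(P)`, with the value `0` if `g` is not square-integrable. The terms of
`u` and `v` beyond the canonical pairs are arbitrary functions, and need some value. -/
def toL2 (P : Measure Ω) (g : Ω → ℝ) : Lp ℝ 2 P :=
  if h : MemLp g 2 P then h.toLp g else 0

omit [IsProbabilityMeasure P] in
lemma coeFn_toL2 {g : Ω → ℝ} (hg : MemLp g 2 P) : toL2 P g =ᵐ[P] g := by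
  rw [toL2, dif_pos hg]; exact hg.coeFn_toLp

omit [IsProbabilityMeasure P] in
lemma inner_toL2 {g h : Ω → ℝ} (hg : MemLp g 2 P) (hh : MemLp h 2 P) :
    ⟪toL2 P g, toL2 P h⟫ = ∫ ω, g ω * h ω ∂P := by
  rw [L2.inner_def]
  refine integral_congr_ae ?_
  filter_upwards [coeFn_toL2 hg, coeFn_toL2 hh] with ω h1 h2
  simp [h1, h2, mul_comm]

omit [IsProbabilityMeasure P] in
lemma norm_toL2_eq_one {g : Ω → ℝ} (hg : MemLp g 2 P) :
    ‖toL2 P g‖ = 1 ↔ ∫ ω, g ω ^ 2 ∂P = 1 := by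
  rw [← sq_eq_sq₀ (norm_nonneg _) zero_le_one, one_pow, ← real_inner_self_eq_norm_sq,
    inner_toL2 hg hg]
  simp [sq]

/-- The space of the centred, square-integrable Borel functions of `X`, as a subspace of
`L²(P)`. -/
def centeredL2 (P : Measure Ω) [IsProbabilityMeasure P] (X : Ω → E) : Submodule ℝ (Lp ℝ 2 P) where
  carrier := {x | ∃ f : E → ℝ, Measurable f ∧ MemLp (fun ω => f (X ω)) 2 P ∧
    ∫ ω, f (X ω) ∂P = 0 ∧ toL2 P (fun ω => f (X ω)) = x}
  zero_mem' := ⟨0, measurable_zero, MemLp.zero, by simp, by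
    rw [toL2, dif_pos (show MemLp (fun ω => (0 : E → ℝ) (X ω)) 2 P from MemLp.zero)]
    exact MemLp.toLp_zero _⟩
  add_mem' := by
    rintro _ _ ⟨f, hf, hf2, hf0, rfl⟩ ⟨g, hg, hg2, hg0, rfl⟩
    have h : MemLp (fun ω => (f + g) (X ω)) 2 P := hf2.add hg2
    refine ⟨f + g, hf.add hg, h, ?_, ?_⟩
    · simp only [Pi.add_apply]
      rw [integral_add (hf2.integrable one_le_two) (hg2.integrable one_le_two), hf0, hg0, add_zero]
    · rw [toL2, toL2, toL2, dif_pos h, dif_pos hf2, dif_pos hg2, ← MemLp.toLp_add]; rfl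
  smul_mem' := by
    rintro c _ ⟨f, hf, hf2, hf0, rfl⟩
    have h : MemLp (fun ω => (c • f) (X ω)) 2 P := hf2.const_smul c
    refine ⟨c • f, hf.const_smul c, h, ?_, ?_⟩
    · simp only [Pi.smul_apply, smul_eq_mul]
      rw [integral_const_mul, hf0, mul_zero]
    · rw [toL2, toL2, dif_pos h, dif_pos hf2, ← MemLp.toLp_const_smul]; rfl

lemma isUnitOrthogonal_iff {u : ℕ → E → ℝ} {i : ℕ}
    (hu : ∀ j < i, MemLp (fun ω => u j (X ω)) 2 P) {x : Lp ℝ 2 P} :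
    IsUnitOrthogonal (centeredL2 P X) (fun j => toL2 P fun ω => u j (X ω)) i x ↔
      ∃ f, IsAdmissible P X u i f ∧ toL2 P (fun ω => f (X ω)) = x := by
  constructor
  · rintro ⟨⟨f, hf, hf2, hf0, rfl⟩, hn, ho⟩
    exact ⟨f, ⟨hf, hf2, hf0, (norm_toL2_eq_one hf2).1 hn, fun j hj => by
      rw [← inner_toL2 hf2 (hu j hj), ho j hj]⟩, rfl⟩
  · rintro ⟨f, ⟨hf, hf2, hf0, hf1, ho⟩, rfl⟩
    exact ⟨⟨f, hf, hf2, hf0, rfl⟩, (norm_toL2_eq_one hf2).2 hf1, fun j hj => by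
      rw [inner_toL2 hf2 (hu j hj), ho j hj]⟩

omit [IsProbabilityMeasure P] in
lemma IsCanonical.memLp_left {k : ℕ} {u : ℕ → E → ℝ} {v : ℕ → F → ℝ}
    (h : IsCanonical P X Y k u v) {i : ℕ} (hi : i < k) : MemLp (fun ω => u i (X ω)) 2 P :=
  (h i hi).1.memLp

omit [IsProbabilityMeasure P] in
lemma IsCanonical.memLp_right {k : ℕ} {u : ℕ → E → ℝ} {v : ℕ → F → ℝ}
    (h : IsCanonical P X Y k u v) {i : ℕ} (hi : i < k) : MemLp (fun ω => v i (Y ω)) 2 P :=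
  (h i hi).2.1.memLp

lemma IsCanonical.isCanonicalSeq {k : ℕ} {u : ℕ → E → ℝ} {v : ℕ → F → ℝ}
    (h : IsCanonical P X Y k u v) :
    IsCanonicalSeq (centeredL2 P X) (centeredL2 P Y) k
      (fun j => toL2 P fun ω => u j (X ω)) (fun j => toL2 P fun ω => v j (Y ω)) := by
  intro i hi
  have hu : ∀ j < i, MemLp (fun ω => u j (X ω)) 2 P := fun j hj => h.memLp_left (hj.trans hi)
  have hv : ∀ j < i, MemLp (fun ω => v j (Y ω)) 2 P := fun j hj => h.memLp_right (hj.trans hi)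
  obtain ⟨h1, h2, h3⟩ := h i hi
  refine ⟨(isUnitOrthogonal_iff hu).2 ⟨_, h1, rfl⟩, (isUnitOrthogonal_iff hv).2 ⟨_, h2, rfl⟩, ?_⟩
  intro x y hx hy
  obtain ⟨f, hf, rfl⟩ := (isUnitOrthogonal_iff hu).1 hx
  obtain ⟨g, hg, rfl⟩ := (isUnitOrthogonal_iff hv).1 hy
  rw [inner_toL2 hf.memLp hg.memLp, inner_toL2 h1.memLp h2.memLp]
  exact h3 f g hf hg

lemma IsExhausted.inner_nonpos {k : ℕ} {u : ℕ → E → ℝ} {v : ℕ → F → ℝ}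
    (he : IsExhausted P X Y k u v) (h : IsCanonical P X Y k u v) {x y : Lp ℝ 2 P}
    (hx : IsUnitOrthogonal (centeredL2 P X) (fun j => toL2 P fun ω => u j (X ω)) k x)
    (hy : IsUnitOrthogonal (centeredL2 P Y) (fun j => toL2 P fun ω => v j (Y ω)) k y) :
    ⟪x, y⟫ ≤ 0 := by
  obtain ⟨f, hf, rfl⟩ := (isUnitOrthogonal_iff fun j hj => h.memLp_left hj).1 hx
  obtain ⟨g, hg, rfl⟩ := (isUnitOrthogonal_iff fun j hj => h.memLp_right hj).1 hy
  rw [inner_toL2 hf.memLp hg.memLp]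
  exact he f g hf hg

/-- The covariance matrix of the canonical vector has the block form `[1, D; D, 1]`, where `D` is
the diagonal matrix of the canonical correlations. -/
lemma IsCanonical.det_covMatrix {k : ℕ} {u : ℕ → E → ℝ} {v : ℕ → F → ℝ}
    (h : IsCanonical P X Y k u v) :
    (covMatrix P (concatVector X Y k u v)).det =
      ∏ i : Fin k, (1 - ⟪toL2 P fun ω => u i (X ω), toL2 P fun ω => v i (Y ω)⟫ ^ 2) := by
  have hc := h.isCanonicalSeq
  set U : ℕ → Lp ℝ 2 P := fun j => toL2 P fun ω => u j (X ω)
  set V : ℕ → Lp ℝ 2 P := fun j => toL2 P fun ω => v j (Y ω)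
  have hU : ∀ i < k, ∀ j < k, ⟪U i, U j⟫ = if i = j then 1 else 0 := by
    intro i hi j hj
    rcases lt_trichotomy i j with h' | rfl | h'
    · rw [real_inner_comm, (hc j hj).1.orthogonal i h', if_neg h'.ne]
    · rw [real_inner_self_eq_norm_sq, (hc i hi).1.norm_eq_one]; simp
    · rw [(hc i hi).1.orthogonal j h', if_neg h'.ne']
  have hV : ∀ i < k, ∀ j < k, ⟪V i, V j⟫ = if i = j then 1 else 0 := by
    intro i hi j hj
    rcases lt_trichotomy i j with h' | rfl | h'
    · rw [real_inner_comm, (hc j hj).2.1.orthogonal i h', if_neg h'.ne]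
    · rw [real_inner_self_eq_norm_sq, (hc i hi).2.1.norm_eq_one]; simp
    · rw [(hc i hi).2.1.orthogonal j h', if_neg h'.ne']
  have hcov : ∀ {f g : Ω → ℝ}, MemLp f 2 P → MemLp g 2 P → ∫ ω, f ω ∂P = 0 →
      cov[f, g; P] = ⟪toL2 P f, toL2 P g⟫ := fun {f g} hf hg hf0 => by
    rw [covariance_eq_sub hf hg, hf0, zero_mul, sub_zero, inner_toL2 hf hg]; rfl
  have hM : covMatrix P (concatVector X Y k u v) = Matrix.fromBlocks 1
      (Matrix.diagonal fun i : Fin k => ⟪U i, V i⟫)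
      (Matrix.diagonal fun i : Fin k => ⟪U i, V i⟫) 1 := by
    ext a b
    rcases a with i | i <;> rcases b with j | j <;>
      simp only [covMatrix, concatVector, Matrix.of_apply, Sum.elim_inl, Sum.elim_inr,
        Matrix.fromBlocks_apply₁₁, Matrix.fromBlocks_apply₁₂, Matrix.fromBlocks_apply₂₁,
        Matrix.fromBlocks_apply₂₂, Matrix.one_apply, Matrix.diagonal_apply]
    · rw [hcov (h.memLp_left i.2) (h.memLp_left j.2) (h i i.2).1.mean]
      simpa [Fin.ext_iff] using hU i i.2 j j.2
    · rw [hcov (h.memLp_left i.2) (h.memLp_right j.2) (h i i.2).1.mean]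
      split_ifs with hij
      · rw [hij]
      · exact hc.inner_eq_zero_of_ne i.2 j.2 fun h' => hij (Fin.ext h')
    · rw [covariance_comm, hcov (h.memLp_left j.2) (h.memLp_right i.2) (h j j.2).1.mean]
      split_ifs with hij
      · rw [hij]
      · exact hc.inner_eq_zero_of_ne j.2 i.2 fun h' => hij (Fin.ext h'.symm)
    · rw [hcov (h.memLp_right i.2) (h.memLp_right j.2) (h i i.2).2.1.mean]
      simpa [Fin.ext_iff] using hV i i.2 j j.2
  rw [hM, Matrix.det_fromBlocks_one₁₁, Matrix.diagonal_mul_diagonal, ← Matrix.diagonal_one,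
    Matrix.diagonal_sub, Matrix.det_diagonal]
  exact Finset.prod_congr rfl fun i _ => by rw [sq]

omit [IsProbabilityMeasure P] [MeasurableSpace E] [MeasurableSpace F] in
lemma logDetObjective_of_pos {k : ℕ} {u : ℕ → E → ℝ} {v : ℕ → F → ℝ}
    (h : 0 < (covMatrix P (concatVector X Y k u v)).det) :
    logDetObjective P X Y k u v =
      ((-(1 / 2) * Real.log (covMatrix P (concatVector X Y k u v)).det : ℝ) : EReal) := by
  rw [logDetObjective, ENNReal.log_ofReal_of_pos h, ← EReal.coe_neg]
  have : (2 : EReal) = ((2 : ℝ) : EReal) := rfl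
  rw [this, ← EReal.coe_div]
  congr 1
  ring

omit [IsProbabilityMeasure P] [MeasurableSpace E] [MeasurableSpace F] in
lemma logDetObjective_of_nonpos {k : ℕ} {u : ℕ → E → ℝ} {v : ℕ → F → ℝ}
    (h : (covMatrix P (concatVector X Y k u v)).det ≤ 0) :
    logDetObjective P X Y k u v = ⊤ := by
  rw [logDetObjective, ENNReal.ofReal_of_nonpos h, ENNReal.log_zero, EReal.neg_bot]
  exact EReal.top_div_of_pos_ne_top two_pos (EReal.coe_ne_top 2)

end SquareIntegrable

/-! ### Lossless Gaussianizations -/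

section Gaussianization

variable {Ω : Type*} [MeasurableSpace Ω] {P : Measure Ω} [IsProbabilityMeasure P]

/-- The map sending a vector `w` to the centred variable `⟪w, A⟫ - E⟪w, A⟫` in `L²(P)`. -/
def centeredProjection {G : Type*} [NormedAddCommGroup G] [InnerProductSpace ℝ G]
    {A : Ω → G} (hA : MemLp A 2 P) : G →ₗ[ℝ] Lp ℝ 2 P where
  toFun w := ((hA.const_inner w).sub (memLp_const (∫ ω, ⟪w, A ω⟫ ∂P))).toLp
    (fun ω => ⟪w, A ω⟫ - ∫ ω, ⟪w, A ω⟫ ∂P)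
  map_add' w w' := by
    rw [← MemLp.toLp_add]
    congr 1
    ext ω
    simp only [inner_add_left, Pi.add_apply]
    rw [integral_add ((hA.const_inner w).integrable one_le_two)
      ((hA.const_inner w').integrable one_le_two)]
    ring
  map_smul' c w := by
    rw [RingHom.id_apply, ← MemLp.toLp_const_smul]
    congr 1
    ext ω
    simp only [real_inner_smul_left, Pi.smul_apply, smul_eq_mul]
    rw [integral_const_mul]
    ring

lemma coeFn_centeredProjection {G : Type*} [NormedAddCommGroup G] [InnerProductSpace ℝ G]
    {A : Ω → G} (hA : MemLp A 2 P) (w : G) :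
    centeredProjection hA w =ᵐ[P] fun ω => ⟪w, A ω⟫ - ∫ ω, ⟪w, A ω⟫ ∂P :=
  ((hA.const_inner w).sub (memLp_const _)).coeFn_toLp

lemma inner_centeredProjection {G G' : Type*} [NormedAddCommGroup G] [InnerProductSpace ℝ G]
    [NormedAddCommGroup G'] [InnerProductSpace ℝ G'] {A : Ω → G} {B : Ω → G'} (hA : MemLp A 2 P)
    (hB : MemLp B 2 P) (x : G) (y : G') :
    ⟪centeredProjection hA x, centeredProjection hB y⟫ =
      cov[fun ω => ⟪x, A ω⟫, fun ω => ⟪y, B ω⟫; P] := by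
  rw [L2.inner_def, covariance]
  refine integral_congr_ae ?_
  filter_upwards [coeFn_centeredProjection hA x, coeFn_centeredProjection hB y] with ω h1 h2
  rw [h1, h2]
  simp [mul_comm]

lemma centeredProjection_mem {E G : Type*} [MeasurableSpace E] [NormedAddCommGroup G]
    [InnerProductSpace ℝ G] [MeasurableSpace G] [OpensMeasurableSpace G] {X : Ω → E} {φ : E → G}
    (hφ : Measurable φ) (hA : MemLp (fun ω => φ (X ω)) 2 P) (w : G) :
    centeredProjection hA w ∈ centeredL2 P X := by
  have h2 : MemLp (fun ω => ⟪w, φ (X ω)⟫ - ∫ ω, ⟪w, φ (X ω)⟫ ∂P) 2 P :=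
    (hA.const_inner w).sub (memLp_const _)
  refine ⟨fun e => ⟪w, φ e⟫ - ∫ ω, ⟪w, φ (X ω)⟫ ∂P, ?_, h2, ?_, ?_⟩
  · exact ((innerSL ℝ w).measurable.comp hφ).sub_const _
  · rw [integral_sub ((hA.const_inner w).integrable one_le_two) (integrable_const _)]; simp
  · rw [toL2, dif_pos h2]; rfl

/-- A lossless Gaussianization yields biorthogonal systems of functions of `X` and of `Y`, whose
correlations bound the mutual information. -/
lemma HasLosslessGaussianization.exists_canonical_correlations {E F : Type*} [MeasurableSpace E]
    [MeasurableSpace F] {X : Ω → E} {Y : Ω → F} {kx ky : ℕ}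
    (h : HasLosslessGaussianization P X Y kx ky) :
    ∃ m ≤ min kx ky, ∃ (a b : Fin m → Lp ℝ 2 P) (ρ : Fin m → ℝ), Antitone ρ ∧ (∀ i, 0 < ρ i) ∧
      Orthonormal ℝ a ∧ Orthonormal ℝ b ∧ (∀ i, a i ∈ centeredL2 P X) ∧
      (∀ i, b i ∈ centeredL2 P Y) ∧ (∀ i j, ⟪a i, b j⟫ = if i = j then ρ i else 0) ∧
      ((∀ i, 0 < 1 - ρ i ^ 2) →
        mutualInfo P X Y ≤ ∑ i, ENNReal.ofReal (-(1 / 2) * Real.log (1 - ρ i ^ 2))) := by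
  obtain ⟨φ, ψ, hφ, hψ, hG, hI⟩ := h
  have hAB : HasGaussianLaw (fun ω => (φ (X ω), ψ (Y ω))) P := ⟨hG⟩
  have hA2 := hAB.fst.memLp_two
  have hB2 := hAB.snd.memLp_two
  obtain ⟨m, hmx, hmy, w, z, ρ, hρ, hpos, hw, hz, hsvd⟩ :=
    exists_singular_vectors (centeredProjection hA2) (centeredProjection hB2)
  rw [finrank_euclideanSpace_fin] at hmx hmy
  have hw' := orthonormal_iff_ite.1 hw
  have hz' := orthonormal_iff_ite.1 hz
  simp only [Function.comp_apply] at hw' hz'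
  refine ⟨m, le_min hmx hmy, _, _, ρ, hρ, hpos, hw, hz,
    fun i => centeredProjection_mem hφ hA2 _, fun i => centeredProjection_mem hψ hB2 _, ?_, ?_⟩
  · intro i j
    simp only [Function.comp_apply]
    rw [hsvd, Finset.sum_eq_single i]
    · rw [hw', hz', if_pos rfl, mul_one]; simp
    · intro l _ hl
      rw [hw', if_neg hl.symm, mul_zero, zero_mul]
    · simp
  · intro h1
    rw [← hI]
    refine mutualInfo_le_sum_of_gaussian m _ _ w z ρ hAB h1 ?_ ?_ ?_
    · intro i j
      rw [← hw' i j, inner_centeredProjection]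
    · intro i j
      rw [← hz' i j, inner_centeredProjection]
    · intro x y
      rw [← inner_centeredProjection hA2 hB2, hsvd]
      refine Finset.sum_congr rfl fun i _ => ?_
      rw [inner_centeredProjection, inner_centeredProjection, covariance_comm (fun ω => ⟪y, _⟫)]

lemma prod_fin_le_prod_fin {m k : ℕ} (hmk : m ≤ k) {s : Fin m → ℝ} {t : Fin k → ℝ}
    (ht0 : ∀ i, 0 ≤ t i) (ht1 : ∀ i, t i ≤ 1) (hst : ∀ i, t (Fin.castLE hmk i) ≤ s i) :
    ∏ i, t i ≤ ∏ i, s i := by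
  obtain ⟨n, rfl⟩ := Nat.exists_eq_add_of_le hmk
  rw [Fin.prod_univ_add]
  calc _ ≤ (∏ i : Fin m, t (Fin.castAdd n i)) * 1 :=
        mul_le_mul_of_nonneg_left (Finset.prod_le_one (fun _ _ => ht0 _) fun _ _ => ht1 _)
          (Finset.prod_nonneg fun _ _ => ht0 _)
    _ ≤ _ := by
        rw [mul_one]
        exact Finset.prod_le_prod (fun _ _ => ht0 _) fun i _ => hst i

/-- If there are no more Gaussian canonical correlations than canonical pairs, the former are
dominated by the latter, and so is the mutual information by the log-det objective. -/
lemma IsCanonical.mutualInfo_le_logDetObjective {E F : Type*} [MeasurableSpace E]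
    [MeasurableSpace F] {X : Ω → E} {Y : Ω → F} {k m : ℕ} {u : ℕ → E → ℝ} {v : ℕ → F → ℝ}
    (h : IsCanonical P X Y k u v) (hmk : m ≤ k) {a b : Fin m → Lp ℝ 2 P} {ρ : Fin m → ℝ}
    (hρ : Antitone ρ) (hpos : ∀ i, 0 < ρ i) (ha : Orthonormal ℝ a) (hb : Orthonormal ℝ b)
    (haX : ∀ i, a i ∈ centeredL2 P X) (hbY : ∀ i, b i ∈ centeredL2 P Y)
    (hab : ∀ i j, ⟪a i, b j⟫ = if i = j then ρ i else 0)
    (hI : (∀ i, 0 < 1 - ρ i ^ 2) →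
      mutualInfo P X Y ≤ ∑ i, ENNReal.ofReal (-(1 / 2) * Real.log (1 - ρ i ^ 2))) :
    (mutualInfo P X Y : EReal) ≤ logDetObjective P X Y k u v := by
  rcases le_or_gt (covMatrix P (concatVector X Y k u v)).det 0 with hd | hd
  · rw [logDetObjective_of_nonpos hd]; exact le_top
  rw [logDetObjective_of_pos hd]
  rw [h.det_covMatrix] at hd ⊢
  have hc := h.isCanonicalSeq
  set σ : ℕ → ℝ := fun i => ⟪toL2 P fun ω => u i (X ω), toL2 P fun ω => v i (Y ω)⟫ with hσ
  have hσ0 : ∀ i : Fin k, 0 ≤ σ i := fun i => hc.inner_nonneg i.2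
  have hσ1 : ∀ i : Fin k, 0 ≤ 1 - σ i ^ 2 := fun i => by
    have h1 : σ i ≤ 1 := hc.inner_le_one i.2
    have h2 := hσ0 i
    nlinarith
  have hσpos : ∀ i : Fin k, 0 < 1 - σ i ^ 2 := fun i =>
    lt_of_le_of_ne (hσ1 i) fun h0 => hd.ne' (Finset.prod_eq_zero (Finset.mem_univ i) h0.symm)
  have hρσ : ∀ i : Fin m, ρ i ≤ σ i := fun i => by
    have hik : (i : ℕ) < k := i.2.trans_le hmk
    obtain ⟨x, y, hx, hy, hxy⟩ :=
      (hc.mono hik.le).exists_inner_ge i.2 ha hb haX hbY hab hρ hpos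
    exact hxy.trans ((hc i hik).2.2 x y hx hy)
  have hle : ∀ i : Fin m, 1 - σ i ^ 2 ≤ 1 - ρ i ^ 2 := fun i =>
    sub_le_sub_left (pow_le_pow_left₀ (hpos i).le (hρσ i) 2) 1
  have hρpos : ∀ i : Fin m, 0 < 1 - ρ i ^ 2 := fun i =>
    (hσpos (Fin.castLE hmk i)).trans_le (hle i)
  have hterm : ∀ i : Fin m, 0 ≤ -(1 / 2) * Real.log (1 - ρ i ^ 2) := fun i => by
    have := Real.log_nonpos (hρpos i).le (by nlinarith [sq_nonneg (ρ i)])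
    linarith
  have hsum : ∑ i, ENNReal.ofReal (-(1 / 2) * Real.log (1 - ρ i ^ 2)) =
      ENNReal.ofReal (-(1 / 2) * Real.log (∏ i, (1 - ρ i ^ 2))) := by
    rw [← ENNReal.ofReal_sum_of_nonneg fun i _ => hterm i, ← Finset.mul_sum,
      Real.log_prod fun i _ => (hρpos i).ne']
  have hprod : ∏ i : Fin k, (1 - σ i ^ 2) ≤ ∏ i, (1 - ρ i ^ 2) :=
    prod_fin_le_prod_fin hmk hσ1 (fun i => by nlinarith [sq_nonneg (σ i)]) hle
  have hlog := Real.log_le_log hd hprod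
  have hp1 : Real.log (∏ i, (1 - ρ i ^ 2)) ≤ 0 := by
    rw [Real.log_prod fun i _ => (hρpos i).ne']
    exact Finset.sum_nonpos fun i _ => by linarith [hterm i]
  calc (mutualInfo P X Y : EReal)
      ≤ (ENNReal.ofReal (-(1 / 2) * Real.log (∏ i, (1 - ρ i ^ 2))) : EReal) :=
        EReal.coe_ennreal_le_coe_ennreal_iff.2 ((hI hρpos).trans hsum.le)
    _ = ((-(1 / 2) * Real.log (∏ i, (1 - ρ i ^ 2)) : ℝ) : EReal) := by
        rw [EReal.coe_ennreal_ofReal, max_eq_left (by linarith)]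
    _ ≤ _ := EReal.coe_le_coe_iff.2 (by linarith)

end Gaussianization

end

theorem mainTheorem5 {Ω : Type*} [MeasurableSpace Ω] (P : Measure Ω) [IsProbabilityMeasure P]
    {dx dy : ℕ} (X : Ω → EuclideanSpace ℝ (Fin dx)) (Y : Ω → EuclideanSpace ℝ (Fin dy))
    (hX : Measurable X) (hY : Measurable Y)
    (u : ℕ → EuclideanSpace ℝ (Fin dx) → ℝ) (v : ℕ → EuclideanSpace ℝ (Fin dy) → ℝ) :
    -- finitely many canonical pairs, all of them extracted: every output dimension
    (∀ k : ℕ, IsCanonical P X Y k u v → IsExhausted P X Y k u v →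
      logDetObjective P X Y k u v < (mutualInfo P X Y : EReal) →
      ∀ kx ky : ℕ, ¬ HasLosslessGaussianization P X Y kx ky) ∧
    -- an infinite sequence of canonical pairs: every output dimension
    ((∀ k : ℕ, IsCanonical P X Y k u v) →
      (⨆ k : ℕ, logDetObjective P X Y k u v) < (mutualInfo P X Y : EReal) →
      ∀ kx ky : ℕ, ¬ HasLosslessGaussianization P X Y kx ky) ∧
    -- the first `k` canonical pairs only: output dimensions with `min kx ky ≤ k`
    (∀ k : ℕ, IsCanonical P X Y k u v →
      logDetObjective P X Y k u v < (mutualInfo P X Y : EReal) →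
      ∀ kx ky : ℕ, min kx ky ≤ k → ¬ HasLosslessGaussianization P X Y kx ky) := by
  refine ⟨fun k hk he hlt kx ky hG => ?_, fun hk hlt kx ky hG => ?_,
    fun k hk hlt kx ky hmin hG => ?_⟩ <;>
  obtain ⟨m, hm, a, b, ρ, hρ, hpos, ha, hb, haX, hbY, hab, hI⟩ := hG.exists_canonical_correlations
  · have hmk : m ≤ k := by
      by_contra! hlt'
      -- a Gaussian pair beyond the `k` canonical ones would leave a correlated admissible pair
      obtain ⟨x, y, hx, hy, hxy⟩ :=
        hk.isCanonicalSeq.exists_inner_ge hlt' ha hb haX hbY hab hρ hpos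
      exact absurd (he.inner_nonpos hk hx hy) (not_le.2 ((hpos _).trans_le hxy))
    exact hlt.not_ge (hk.mutualInfo_le_logDetObjective hmk hρ hpos ha hb haX hbY hab hI)
  · exact hlt.not_ge (((hk m).mutualInfo_le_logDetObjective le_rfl hρ hpos ha hb haX hbY hab
      hI).trans (le_iSup (fun k => logDetObjective P X Y k u v) m))
  · exact hlt.not_ge
      (hk.mutualInfo_le_logDetObjective (hm.trans hmin) hρ hpos ha hb haX hbY hab hI)
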